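/- An effect algebra is a set $E$ with elements $0,1$ and a partially defined operation $\oplus$, commutative and associative in the sense that (EA1) if $e\oplus f$ is defined, so is $f\oplus e$ and they are equal; (EA2) if $d\oplus e$ and $(d\oplus e)\oplus f$ are defined, so are $e\oplus f$ and $d\oplus(e\oplus f)$, and $(d\oplus e)\oplus f=d\oplus(e\oplus f)$; (EA3) for each $e$ there is a unique $e^\perp$ with $e\oplus e^\perp=1$; (EA4) $e\oplus 1$ is defined only if $e=0$. Write $a\perp b$ if $a\oplus b$ is defined. The real interval $[0,1]$ is an effect algebra with $\alpha\oplus\beta:=\alpha+\beta$ defined iff $\alpha+\beta\le 1$. A morphism $\phi:E\to F$ of effect algebras satisfies $\phi(1)=1$, and $p\perp q$ implies $\phi(p)\perp\phi(q)$ and $\phi(p\oplus q)=\phi(p)\oplus\phi(q)$; it is a monomorphism if moreover $\phi(p)\perp\phi(q)$ implies $p\perp q$. A state on $E$ is a morphism $E\to[0,1]$. A state operator on $E$ is a morphism $\tau:E\to E$ with $\tau(\tau(a))=\tau(a)$ for all $a\in E$. A bimorphism $\beta:P\times Q\to L$ of effect algebras is a map with $\beta(1,1)=1$ that preserves existing orthosums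 in each variable separately. A tensor product of $P$ and $Q$ (in the category of effect algebras) is an effect algebra $T$ with a bimorphism $\rho:P\times Q\to T$, written $\rho(p,q)=p\otimes q$, such that for every effect algebra $L$ and every bimorphism $\beta:P\times Q\to L$ there is a unique morphism $\phi:T\to L$ with $\beta=\phi\circ\rho$. **Theorem.** Let $E$ be an effect algebra and let $s:E\to[0,1]$ be a state on $E$. Then a tensor product of $[0,1]$ and $E$ exists in the category of effect algebras. Moreover, for every tensor product $([0,1]\otimes E,\otimes)$ of $[0,1]$ and $E$: 1. the map $\alpha\mapsto\alpha\otimes 1$ is a monomorphism $[0,1]\to[0,1]\otimes E$ whose image $[0,1]\otimes 1=\{\alpha\otimes 1:\alpha\in[0,1]\}$ is a subeffect algebra (that is, contains $1$ and is closed under $\perp$ and existing orthosums), so that it is an isomorphism of $[0,1]$ onto $[0,1]\otimes 1$; 2. there is a unique state $i\otimes s:[0,1]\otimes E\to[0,1]$ with $(i\otimes s)(\alpha\otimes a)=\alpha\, s(a)$ for all $\alpha\in[0,1]$, $a\in E$ (where $i$ is the identity of $[0,1]$); 3. the map $\tau:[0,1]\otimes E\to[0,1]\otimes E$, $\tau(x)=\big((i\otimes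 s)(x)\big)\otimes 1$, is a state operator on $[0,1]\otimes E$, and $\tau(\alpha\otimes a)=\alpha s(a)\otimes 1$ for all $\alpha\in[0,1]$, $a\in E$. -/

import Mathlib

universe u

/-- An effect algebra. The partially defined orthosummation is a map into `Option E`:
`osum e f = some x` says that `e ⊕ f` is defined and equal to `x`. -/
class EffectAlgebra (E : Type*) extends Zero E, One E where
  osum : E → E → Option E
  osum_comm : ∀ e f x : E, osum e f = some x → osum f e = some x
  osum_assoc : ∀ d e f x y : E, osum d e = some x → osum x f = some y →
    ∃ z : E, osum e f = some z ∧ osum d z = some y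
  existsUnique_orthosupplement : ∀ e : E, ∃! f : E, osum e f = some 1
  eq_zero_of_osum_one : ∀ e x : E, osum e 1 = some x → e = 0

namespace EffectAlgebra

/-- `p ⊥ q`: the orthosum `p ⊕ q` is defined. -/
def Perp {E : Type*} [EffectAlgebra E] (p q : E) : Prop :=
  ∃ x : E, osum p q = some x

/-- A morphism: `φ 1 = 1`, and if `p ⊥ q` then `φ p ⊥ φ q` and `φ (p ⊕ q) = φ p ⊕ φ q`. -/
structure IsMorphism {E F : Type*} [EffectAlgebra E] [EffectAlgebra F] (φ : E → F) : Prop where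
  map_one : φ 1 = 1
  map_osum : ∀ p q r : E, osum p q = some r → osum (φ p) (φ q) = some (φ r)

/-- A monomorphism: a morphism `φ` with `φ p ⊥ φ q` iff `p ⊥ q`. -/
structure IsMonomorphism {E F : Type*} [EffectAlgebra E] [EffectAlgebra F] (φ : E → F) : Prop
    extends IsMorphism φ where
  perp_iff : ∀ p q : E, Perp (φ p) (φ q) ↔ Perp p q

/-- A subeffect algebra: a subset that contains `1` and is closed under orthosupplements and under
existing orthosums. -/
structure IsSubEffectAlgebra {E : Type*} [EffectAlgebra E] (S : Set E) : Prop where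
  one_mem : (1 : E) ∈ S
  orthosupplement_mem : ∀ a b : E, a ∈ S → osum a b = some 1 → b ∈ S
  osum_mem : ∀ a b c : E, a ∈ S → b ∈ S → osum a b = some c → c ∈ S

/-- The effect algebra `[0,1] ⊆ ℝ`: `a ⊕ b` is defined iff `a + b ≤ 1`, and then it is `a + b`. -/
noncomputable instance instUnitInterval : EffectAlgebra unitInterval where
  toZero := inferInstance
  toOne := inferInstance
  osum a b :=
    if h : (a : ℝ) + (b : ℝ) ≤ 1 then some ⟨(a : ℝ) + (b : ℝ), add_nonneg a.2.1 b.2.1, h⟩ else none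
  osum_comm e f x hx := by
    rw [Option.dite_none_right_eq_some] at hx ⊢
    obtain ⟨h, hx⟩ := hx
    refine ⟨by linarith, ?_⟩
    rw [← hx]
    simp only [add_comm]
  osum_assoc d e f x y hx hy := by
    rw [Option.dite_none_right_eq_some] at hx hy
    obtain ⟨h, hx⟩ := hx
    obtain ⟨h', hy⟩ := hy
    simp only [Option.some.injEq] at hx hy
    subst hx
    subst hy
    have hd := d.2.1
    simp only at h'
    refine ⟨⟨(e : ℝ) + f, add_nonneg e.2.1 f.2.1, by linarith⟩, ?_, ?_⟩
    · rw [dif_pos (by linarith)]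
    · rw [dif_pos (by simp only; linarith)]
      simp only [add_assoc]
  existsUnique_orthosupplement e := by
    refine ⟨unitInterval.symm e, ?_, ?_⟩
    · have h : (e : ℝ) + (unitInterval.symm e : ℝ) ≤ 1 := by
        rw [unitInterval.coe_symm_eq]; linarith
      refine (dif_pos h).trans ?_
      congr 1
      apply Subtype.ext
      change (e : ℝ) + (1 - e) = 1
      ring
    · intro f hf
      rw [Option.dite_none_right_eq_some] at hf
      obtain ⟨h, hf⟩ := hf
      have h1 := congrArg Subtype.val (Option.some.inj hf)
      change (e : ℝ) + f = 1 at h1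
      apply Subtype.ext
      rw [unitInterval.coe_symm_eq]
      linarith
  eq_zero_of_osum_one e x hx := by
    rw [Option.dite_none_right_eq_some] at hx
    obtain ⟨h, -⟩ := hx
    have h1 : (e : ℝ) + 1 ≤ 1 := h
    have h0 := e.2.1
    apply Subtype.ext
    change (e : ℝ) = 0
    linarith

/-- A state on `E`: a morphism from `E` into the effect algebra `[0,1]`. -/
def IsState {E : Type*} [EffectAlgebra E] (s : E → unitInterval) : Prop :=
  IsMorphism s

/-- A state operator on `E`: a unital, additive and idempotent map from `E` to itself. -/
structure IsStateOperator {E : Type*} [EffectAlgebra E] (τ : E → E) : Prop where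
  map_one : τ 1 = 1
  map_osum : ∀ e f x : E, osum e f = some x → osum (τ e) (τ f) = some (τ x)
  idem : ∀ a : E, τ (τ a) = τ a

/-- A bimorphism of effect algebras. -/
structure IsBimorphism {P Q L : Type*} [EffectAlgebra P] [EffectAlgebra Q] [EffectAlgebra L]
    (β : P → Q → L) : Prop where
  map_osum_left : ∀ (a b c : P) (q : Q), osum a b = some c →
    osum (β a q) (β b q) = some (β c q)
  map_osum_right : ∀ (p : P) (c d e : Q), osum c d = some e →
    osum (β p c) (β p d) = some (β p e)
  map_one_one : β 1 1 = 1

/-- `(T, ρ)` is a tensor product of `P` and `Q` in the category of effect algebras: `ρ` is a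
bimorphism and every bimorphism on `P × Q` factors through `ρ` by a unique morphism. -/
structure IsTensorProduct {P Q : Type*} {T : Type u}
    [EffectAlgebra P] [EffectAlgebra Q] [EffectAlgebra T] (ρ : P → Q → T) : Prop where
  isBimorphism : IsBimorphism ρ
  existsUnique_lift : ∀ (L : Type u) [EffectAlgebra L] (β : P → Q → L), IsBimorphism β →
    ∃! φ : T → L, IsMorphism φ ∧ ∀ (p : P) (q : Q), φ (ρ p q) = β p q

/-- `m` is a product state `μ ⊗ ν` on `(T, ρ)`: a state with `m (p ⊗ q) = μ p * ν q`. -/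
structure IsProductState {P Q T : Type*} [EffectAlgebra P] [EffectAlgebra Q] [EffectAlgebra T]
    (ρ : P → Q → T) (μ : P → unitInterval) (ν : Q → unitInterval) (m : T → unitInterval) :
    Prop where
  isState : IsState m
  apply_tmul : ∀ (p : P) (q : Q), m (ρ p q) = μ p * ν q

end EffectAlgebra

namespace EffectAlgebra

universe v w

section Basic

variable {E F G : Type*} [EffectAlgebra E] [EffectAlgebra F] [EffectAlgebra G]

/-! The tensor product is the part of the product of all targets of bimorphisms that is generated by
the elementary tensors. Formal expressions in `p ⊗ q`, orthosupplement and orthosum are kept when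
every bimorphism can evaluate them, and identified when every bimorphism gives them the same value.
The axioms then hold pointwise. Testing against all targets in a universe costs no universe level,
since the carrier is a quotient of a set of expressions.

The rest follows from a retraction. The bimorphism `(α, a) ↦ α * s a` induces the state `m`, and `s
1 = 1` makes `m` a left inverse of `α ↦ α ⊗ 1`. A morphism with a left inverse morphism reflects
orthogonality, and the composite in the other order is idempotent. -/

theorem eq_of_osum_eq_one {a b c : E} (hb : osum a b = some 1) (hc : osum a c = some 1) :
    b = c :=
  (existsUnique_orthosupplement a).unique hb hc

/-- The orthosupplement of an element. -/
noncomputable def orthosupplement (e : E) : E :=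
  (existsUnique_orthosupplement e).choose

theorem osum_orthosupplement (e : E) : osum e (orthosupplement e) = some 1 :=
  (existsUnique_orthosupplement e).choose_spec.1

theorem orthosupplement_one : orthosupplement (1 : E) = 0 :=
  eq_zero_of_osum_one _ _ (osum_comm _ _ _ (osum_orthosupplement (1 : E)))

theorem IsMorphism.map_orthosupplement {φ : E → F} (hφ : IsMorphism φ) (e : E) :
    φ (orthosupplement e) = orthosupplement (φ e) := by
  refine eq_of_osum_eq_one (a := φ e) ?_ (osum_orthosupplement _)
  rw [← hφ.map_one]
  exact hφ.map_osum _ _ _ (osum_orthosupplement e)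

theorem IsMorphism.comp {ψ : F → G} {φ : E → F} (hψ : IsMorphism ψ) (hφ : IsMorphism φ) :
    IsMorphism (fun x => ψ (φ x)) where
  map_one := by rw [hφ.map_one, hψ.map_one]
  map_osum p q r h := hψ.map_osum _ _ _ (hφ.map_osum p q r h)

end Basic

/-! ### Universe lifting -/

section ULift

theorem map_up_eq_some_iff {X : Type v} {o : Option X} {x : ULift.{w} X} :
    o.map ULift.up = some x ↔ o = some x.down := by
  cases o <;> simp [ULift.ext_iff]

variable {E : Type v} [EffectAlgebra E]

/-- Needed because the universal property only tests targets in `Type u`, while `unitInterval` lives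
in `Type`. -/
instance instULift : EffectAlgebra (ULift.{w} E) where
  zero := ⟨0⟩
  one := ⟨1⟩
  osum a b := (osum a.down b.down).map ULift.up
  osum_comm e f x h := by
    rw [map_up_eq_some_iff] at h ⊢
    exact osum_comm _ _ _ h
  osum_assoc d e f x y hx hy := by
    rw [map_up_eq_some_iff] at hx hy
    obtain ⟨z, hz, hz'⟩ := osum_assoc _ _ _ _ _ hx hy
    exact ⟨⟨z⟩, map_up_eq_some_iff.2 hz, map_up_eq_some_iff.2 hz'⟩
  existsUnique_orthosupplement e := by
    refine ⟨⟨orthosupplement e.down⟩, map_up_eq_some_iff.2 (osum_orthosupplement _), ?_⟩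
    intro f hf
    exact ULift.ext _ _ (eq_of_osum_eq_one (map_up_eq_some_iff.1 hf) (osum_orthosupplement _))
  eq_zero_of_osum_one e x h :=
    ULift.ext _ _ (eq_zero_of_osum_one _ _ (map_up_eq_some_iff.1 h))

theorem isMorphism_up : IsMorphism (ULift.up : E → ULift.{w} E) where
  map_one := rfl
  map_osum _ _ _ h := map_up_eq_some_iff.2 h

theorem isMorphism_down : IsMorphism (ULift.down : ULift.{w} E → E) where
  map_one := rfl
  map_osum _ _ _ h := map_up_eq_some_iff.1 h

end ULift

theorem IsMorphism.comp_isBimorphism {P Q L M : Type*} [EffectAlgebra P] [EffectAlgebra Q]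
    [EffectAlgebra L] [EffectAlgebra M] {φ : L → M} {β : P → Q → L} (hφ : IsMorphism φ)
    (hβ : IsBimorphism β) : IsBimorphism (fun p q => φ (β p q)) where
  map_osum_left a b c q h := hφ.map_osum _ _ _ (hβ.map_osum_left a b c q h)
  map_osum_right p c d e h := hφ.map_osum _ _ _ (hβ.map_osum_right p c d e h)
  map_one_one := by rw [hβ.map_one_one, hφ.map_one]

section UnitInterval

theorem unitInterval_osum_eq_some_iff {a b c : unitInterval} :
    osum a b = some c ↔ (a : ℝ) + b = c := by
  change (dite _ _ _ : Option unitInterval) = some c ↔ _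
  rw [Option.dite_none_right_eq_some]
  constructor
  · rintro ⟨h, hc⟩
    exact congrArg Subtype.val (Option.some.inj hc)
  · intro h
    exact ⟨h ▸ c.2.2, congrArg some (Subtype.ext h)⟩

/-- The product of two states, as a bimorphism. -/
theorem isBimorphism_mul {P Q : Type*} [EffectAlgebra P] [EffectAlgebra Q]
    {μ : P → unitInterval} {ν : Q → unitInterval} (hμ : IsState μ) (hν : IsState ν) :
    IsBimorphism (fun p q => μ p * ν q) where
  map_osum_left a b c q h := by
    have := unitInterval_osum_eq_some_iff.1 (hμ.map_osum a b c h)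
    rw [unitInterval_osum_eq_some_iff]
    push_cast
    rw [← this, add_mul]
  map_osum_right p c d e h := by
    have := unitInterval_osum_eq_some_iff.1 (hν.map_osum c d e h)
    rw [unitInterval_osum_eq_some_iff]
    push_cast
    rw [← this, mul_add]
  map_one_one := by rw [hμ.map_one, hν.map_one, one_mul]

theorem isState_id : IsState (id : unitInterval → unitInterval) :=
  ⟨rfl, fun _ _ _ h => h⟩

end UnitInterval

/-! ### Existence of tensor products -/

section TensorConstruction

/-- Formal expressions in the elements `p ⊗ q`. -/
inductive TensorTerm (P : Type v) (Q : Type w) : Type (max v w)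
  | tmul : P → Q → TensorTerm P Q
  | compl : TensorTerm P Q → TensorTerm P Q
  | sum : TensorTerm P Q → TensorTerm P Q → TensorTerm P Q

/-- Evaluation of an expression along a map `β`; undefined orthosums are sent to `0`. -/
noncomputable def TensorTerm.eval {P : Type v} {Q : Type w} {L : Type*} [EffectAlgebra L]
    (β : P → Q → L) : TensorTerm P Q → L
  | .tmul p q => β p q
  | .compl x => orthosupplement (x.eval β)
  -- The default `0` is never reached on the expressions kept below, where both sides are orthogonal
  -- under every bimorphism considered.
  | .sum x y => (osum (x.eval β) (y.eval β)).getD 0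

variable {P : Type v} {Q : Type w} [EffectAlgebra P] [EffectAlgebra Q]

/-- Expressions all of whose orthosums are defined under every bimorphism. -/
inductive TensorTerm.IsDefined : TensorTerm P Q → Prop
  | tmul (p : P) (q : Q) : IsDefined (.tmul p q)
  | compl {x : TensorTerm P Q} : IsDefined x → IsDefined (.compl x)
  | sum {x y : TensorTerm P Q} : IsDefined x → IsDefined y →
      (∀ (L : Type (max v w)) [EffectAlgebra L] (β : P → Q → L), IsBimorphism β →
        Perp (x.eval β) (y.eval β)) → IsDefined (.sum x y)

variable (P Q) in
/-- Two expressions are identified if they agree under every bimorphism. -/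
def tensorSetoid : Setoid {x : TensorTerm P Q // x.IsDefined} where
  r x y := ∀ (L : Type (max v w)) [EffectAlgebra L] (β : P → Q → L), IsBimorphism β →
    x.1.eval β = y.1.eval β
  iseqv :=
    { refl := fun _ _ _ _ _ => rfl
      symm := fun h L _ β hβ => (h L β hβ).symm
      trans := fun h h' L _ β hβ => (h L β hβ).trans (h' L β hβ) }

variable (P Q) in
/-- The tensor product of two effect algebras. -/
def Tensor : Type (max v w) := Quotient (tensorSetoid P Q)

namespace Tensor

variable {L : Type (max v w)} [EffectAlgebra L]

/-- The class of a defined expression. -/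
def mk (x : TensorTerm P Q) (hx : x.IsDefined) : Tensor P Q :=
  Quotient.mk (tensorSetoid P Q) ⟨x, hx⟩

/-- The elementary tensor `p ⊗ q`. -/
def tmul (p : P) (q : Q) : Tensor P Q := mk (.tmul p q) (.tmul p q)

theorem exists_mk_eq (a : Tensor P Q) : ∃ x hx, mk x hx = a := by
  obtain ⟨⟨x, hx⟩, rfl⟩ := Quotient.exists_rep a
  exact ⟨x, hx, rfl⟩

/-- The map out of the tensor product induced by a bimorphism. -/
noncomputable def lift (β : P → Q → L) (hβ : IsBimorphism β) (a : Tensor P Q) : L :=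
  Quotient.lift (s := tensorSetoid P Q) (fun x => x.1.eval β) (fun _ _ h => h L β hβ) a

theorem lift_mk (β : P → Q → L) (hβ : IsBimorphism β) (x : TensorTerm P Q) (hx : x.IsDefined) :
    lift β hβ (mk x hx) = x.eval β := rfl

/-- The induced maps jointly separate points, so equations in the tensor product may be checked in
each target. -/
theorem ext_lift {a b : Tensor P Q}
    (h : ∀ (L : Type (max v w)) [EffectAlgebra L] (β : P → Q → L) (hβ : IsBimorphism β),
      lift β hβ a = lift β hβ b) : a = b := by
  obtain ⟨x, hx, rfl⟩ := exists_mk_eq a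
  obtain ⟨y, hy, rfl⟩ := exists_mk_eq b
  exact Quotient.sound (s := tensorSetoid P Q) fun L _ β hβ => h L β hβ

/-- `c` is the orthosum of `a` and `b` under every bimorphism. -/
def IsSum (a b c : Tensor P Q) : Prop :=
  ∀ (L : Type (max v w)) [EffectAlgebra L] (β : P → Q → L) (hβ : IsBimorphism β),
    osum (lift β hβ a) (lift β hβ b) = some (lift β hβ c)

theorem IsSum.unique {a b c d : Tensor P Q} (hc : IsSum a b c) (hd : IsSum a b d) : c = d :=
  ext_lift fun L _ β hβ => Option.some.inj ((hc L β hβ).symm.trans (hd L β hβ))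

theorem isSum_mk_sum {x y : TensorTerm P Q} (hx : x.IsDefined) (hy : y.IsDefined)
    (h : ∀ (L : Type (max v w)) [EffectAlgebra L] (β : P → Q → L), IsBimorphism β →
      Perp (x.eval β) (y.eval β)) :
    IsSum (mk x hx) (mk y hy) (mk (.sum x y) (.sum hx hy h)) := by
  intro L _ β hβ
  obtain ⟨z, hz⟩ := h L β hβ
  simp only [lift_mk, TensorTerm.eval, hz, Option.getD_some]

/-- Pointwise orthogonality is exactly what makes the formal sum of two representatives a defined
expression. This supplies the inner sum in associativity. -/
theorem exists_isSum {a b : Tensor P Q}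
    (h : ∀ (L : Type (max v w)) [EffectAlgebra L] (β : P → Q → L) (hβ : IsBimorphism β),
      Perp (lift β hβ a) (lift β hβ b)) : ∃ c, IsSum a b c := by
  obtain ⟨x, hx, rfl⟩ := exists_mk_eq a
  obtain ⟨y, hy, rfl⟩ := exists_mk_eq b
  exact ⟨_, isSum_mk_sum hx hy fun L _ β hβ => h L β hβ⟩

theorem exists_lift_eq_orthosupplement (a : Tensor P Q) : ∃ b : Tensor P Q,
    ∀ (L : Type (max v w)) [EffectAlgebra L] (β : P → Q → L) (hβ : IsBimorphism β),
      lift β hβ b = orthosupplement (lift β hβ a) := by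
  obtain ⟨x, hx, rfl⟩ := exists_mk_eq a
  exact ⟨mk (.compl x) (.compl hx), fun L _ β hβ => rfl⟩

open Classical in
/-- The orthosum of the tensor product. -/
noncomputable def tensorSum (a b : Tensor P Q) : Option (Tensor P Q) :=
  if h : ∃ c, IsSum a b c then some h.choose else none

theorem tensorSum_eq_some_iff {a b c : Tensor P Q} : tensorSum a b = some c ↔ IsSum a b c := by
  rw [tensorSum, Option.dite_none_right_eq_some]
  constructor
  · rintro ⟨h, hc⟩
    exact Option.some.inj hc ▸ h.choose_spec
  · intro hc
    have h : ∃ c, IsSum a b c := ⟨c, hc⟩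
    exact ⟨h, congrArg some (h.choose_spec.unique hc)⟩

instance : One (Tensor P Q) := ⟨tmul 1 1⟩

/-- Expressions have no constant for zero, so it is obtained as the orthosupplement of one. -/
instance : Zero (Tensor P Q) := ⟨mk (.compl (.tmul 1 1)) (.compl (.tmul 1 1))⟩

theorem lift_tmul (β : P → Q → L) (hβ : IsBimorphism β) (p : P) (q : Q) :
    lift β hβ (tmul p q) = β p q := rfl

theorem lift_one (β : P → Q → L) (hβ : IsBimorphism β) : lift β hβ 1 = 1 :=
  hβ.map_one_one

theorem lift_zero (β : P → Q → L) (hβ : IsBimorphism β) : lift β hβ 0 = 0 := by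
  change orthosupplement (β 1 1) = 0
  rw [hβ.map_one_one, orthosupplement_one]

noncomputable instance : EffectAlgebra (Tensor P Q) where
  osum := tensorSum
  osum_comm e f x h := by
    rw [tensorSum_eq_some_iff] at h ⊢
    exact fun L _ β hβ => osum_comm _ _ _ (h L β hβ)
  osum_assoc d e f x y hx hy := by
    rw [tensorSum_eq_some_iff] at hx hy
    obtain ⟨z, hz⟩ : ∃ z, IsSum e f z := exists_isSum fun L _ β hβ => by
      obtain ⟨z, hz, -⟩ := osum_assoc _ _ _ _ _ (hx L β hβ) (hy L β hβ)
      exact ⟨z, hz⟩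
    refine ⟨z, tensorSum_eq_some_iff.2 hz, tensorSum_eq_some_iff.2 fun L _ β hβ => ?_⟩
    -- The witness in `L` must be the image of the global `z`, as both are the value of the same
    -- orthosum.
    obtain ⟨z', hz', hy'⟩ := osum_assoc _ _ _ _ _ (hx L β hβ) (hy L β hβ)
    rwa [Option.some.inj ((hz L β hβ).symm.trans hz')]
  existsUnique_orthosupplement e := by
    obtain ⟨f, hf⟩ := exists_lift_eq_orthosupplement e
    refine ⟨f, tensorSum_eq_some_iff.2 fun L _ β hβ => ?_, fun g hg => ?_⟩
    · rw [hf, lift_one]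
      exact osum_orthosupplement _
    · refine ext_lift fun L _ β hβ => ?_
      have h := tensorSum_eq_some_iff.1 hg L β hβ
      rw [lift_one] at h
      rw [hf]
      exact eq_of_osum_eq_one h (osum_orthosupplement _)
  eq_zero_of_osum_one e x h := by
    refine ext_lift fun L _ β hβ => ?_
    have h' := tensorSum_eq_some_iff.1 h L β hβ
    rw [lift_one] at h'
    rw [lift_zero]
    exact eq_zero_of_osum_one _ _ h'

theorem osum_eq_some_iff {a b c : Tensor P Q} : osum a b = some c ↔ IsSum a b c :=
  tensorSum_eq_some_iff

theorem isMorphism_lift (β : P → Q → L) (hβ : IsBimorphism β) : IsMorphism (lift β hβ) where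
  map_one := lift_one β hβ
  map_osum _ _ _ h := osum_eq_some_iff.1 h L β hβ

theorem mk_compl {x : TensorTerm P Q} (hx : x.IsDefined) :
    mk (.compl x) (.compl hx) = orthosupplement (mk x hx) :=
  ext_lift fun L _ β hβ => by
    rw [(isMorphism_lift β hβ).map_orthosupplement]
    rfl

/-- Elementary tensors generate: morphisms preserve orthosupplements and existing orthosums, so
induction on defined expressions determines `φ`. -/
theorem eq_lift {β : P → Q → L} (hβ : IsBimorphism β) {φ : Tensor P Q → L} (hφ : IsMorphism φ)
    (h : ∀ p q, φ (tmul p q) = β p q) : φ = lift β hβ := by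
  funext a
  obtain ⟨x, hx, rfl⟩ := exists_mk_eq a
  induction hx with
  | tmul p q => exact h p q
  | compl hx ih =>
    rw [mk_compl hx, hφ.map_orthosupplement, (isMorphism_lift β hβ).map_orthosupplement, ih]
  | sum hx hy hxy ihx ihy =>
    have hs := osum_eq_some_iff.2 (isSum_mk_sum hx hy hxy)
    have h1 := hφ.map_osum _ _ _ hs
    have h2 := (isMorphism_lift β hβ).map_osum _ _ _ hs
    rw [ihx, ihy] at h1
    exact Option.some.inj (h1.symm.trans h2)

theorem isBimorphism_tmul : IsBimorphism (tmul : P → Q → Tensor P Q) where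
  map_osum_left a b c q h :=
    osum_eq_some_iff.2 fun _ _ _ hβ => hβ.map_osum_left a b c q h
  map_osum_right p c d e h :=
    osum_eq_some_iff.2 fun _ _ _ hβ => hβ.map_osum_right p c d e h
  map_one_one := rfl

theorem isTensorProduct_tmul : IsTensorProduct (tmul : P → Q → Tensor P Q) where
  isBimorphism := isBimorphism_tmul
  existsUnique_lift _ _ β hβ :=
    ⟨lift β hβ, ⟨isMorphism_lift β hβ, lift_tmul β hβ⟩, fun _ h => eq_lift hβ h.1 h.2⟩

end Tensor

end TensorConstruction

/-! ### Product states -/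

section ProductState

variable {P Q : Type*} {T : Type u} [EffectAlgebra P] [EffectAlgebra Q] [EffectAlgebra T]
  {ρ : P → Q → T} {μ : P → unitInterval} {ν : Q → unitInterval}

theorem IsTensorProduct.existsUnique_isProductState (hρ : IsTensorProduct ρ) (hμ : IsState μ)
    (hν : IsState ν) : ∃! m : T → unitInterval, IsProductState ρ μ ν m := by
  obtain ⟨φ, ⟨hφ, hφρ⟩, huniq⟩ := hρ.existsUnique_lift (ULift.{u} unitInterval) _
    (isMorphism_up.comp_isBimorphism (isBimorphism_mul hμ hν))
  refine ⟨fun x => (φ x).down, ⟨isMorphism_down.comp hφ, fun p q => ?_⟩, fun m hm => ?_⟩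
  · rw [hφρ]
  · have := huniq (fun x => ULift.up (m x))
      ⟨isMorphism_up.comp hm.isState, fun p q => congrArg ULift.up (hm.apply_tmul p q)⟩
    funext x
    exact congrArg ULift.down (congrFun this x)

end ProductState

/-! ### Morphisms with a retraction -/

section Range

variable {E F : Type*} [EffectAlgebra E] [EffectAlgebra F]

/-- Reflection of orthogonality is needed only for orthosums: it pulls a sum in the target back to
one in the source. -/
theorem IsMonomorphism.isSubEffectAlgebra_range {φ : E → F} (hφ : IsMonomorphism φ) :
    IsSubEffectAlgebra (Set.range φ) where
  one_mem := ⟨1, hφ.map_one⟩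
  orthosupplement_mem := by
    rintro _ b ⟨a, rfl⟩ h
    refine ⟨orthosupplement a, ?_⟩
    rw [hφ.toIsMorphism.map_orthosupplement]
    exact eq_of_osum_eq_one (osum_orthosupplement _) h
  osum_mem := by
    rintro _ _ c ⟨a, rfl⟩ ⟨b, rfl⟩ h
    obtain ⟨d, hd⟩ := (hφ.perp_iff a b).1 ⟨c, h⟩
    exact ⟨d, Option.some.inj ((hφ.map_osum a b d hd).symm.trans h)⟩

/-- Applying `ψ` to an orthosum of `φ p` and `φ q` yields an orthosum of `p` and `q`. -/
theorem IsMorphism.isMonomorphism_of_leftInverse {φ : E → F} {ψ : F → E} (hφ : IsMorphism φ)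
    (hψ : IsMorphism ψ) (h : Function.LeftInverse ψ φ) : IsMonomorphism φ where
  toIsMorphism := hφ
  perp_iff p q := by
    refine ⟨fun ⟨x, hx⟩ => ⟨ψ x, ?_⟩, fun ⟨x, hx⟩ => ⟨φ x, hφ.map_osum _ _ _ hx⟩⟩
    simpa only [h p, h q] using hψ.map_osum _ _ _ hx

theorem IsMorphism.isStateOperator_of_leftInverse {φ : E → F} {ψ : F → E} (hφ : IsMorphism φ)
    (hψ : IsMorphism ψ) (h : Function.LeftInverse ψ φ) :
    IsStateOperator (fun x => φ (ψ x)) where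
  map_one := (hφ.comp hψ).map_one
  map_osum := (hφ.comp hψ).map_osum
  idem a := by rw [h]

end Range

theorem IsBimorphism.isMorphism_left {P Q L : Type*} [EffectAlgebra P] [EffectAlgebra Q]
    [EffectAlgebra L] {β : P → Q → L} (hβ : IsBimorphism β) : IsMorphism (fun p => β p 1) where
  map_one := hβ.map_one_one
  map_osum a b c h := hβ.map_osum_left a b c 1 h

end EffectAlgebra

theorem mainTheorem10 {E : Type u} [EffectAlgebra E] (s : E → unitInterval)
    (hs : EffectAlgebra.IsState s) :
    (∃ (T : Type u) (_ : EffectAlgebra T) (ρ : unitInterval → E → T),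
      EffectAlgebra.IsTensorProduct ρ) ∧
    ∀ (T : Type u) [EffectAlgebra T] (ρ : unitInterval → E → T),
      EffectAlgebra.IsTensorProduct ρ →
      EffectAlgebra.IsMonomorphism (fun α : unitInterval => ρ α 1) ∧
      EffectAlgebra.IsSubEffectAlgebra (Set.range (fun α : unitInterval => ρ α 1)) ∧
      ∃ m : T → unitInterval,
        EffectAlgebra.IsProductState ρ (id : unitInterval → unitInterval) s m ∧
        (∀ m' : T → unitInterval,
          EffectAlgebra.IsProductState ρ (id : unitInterval → unitInterval) s m' → m' = m) ∧
        EffectAlgebra.IsStateOperator (fun x : T => ρ (m x) 1) ∧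
        ∀ (α : unitInterval) (a : E), ρ (m (ρ α a)) 1 = ρ (α * s a) 1 := by
  refine ⟨⟨EffectAlgebra.Tensor unitInterval E, inferInstance, EffectAlgebra.Tensor.tmul,
    EffectAlgebra.Tensor.isTensorProduct_tmul⟩, ?_⟩
  intro T _ ρ hρ
  obtain ⟨m, hm, huniq⟩ := hρ.existsUnique_isProductState EffectAlgebra.isState_id hs
  have hι := hρ.isBimorphism.isMorphism_left
  have hinv : Function.LeftInverse m (fun α : unitInterval => ρ α 1) := fun α => by
    rw [hm.apply_tmul, hs.map_one, mul_one, id]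
  have hmono := hι.isMonomorphism_of_leftInverse hm.isState hinv
  refine ⟨hmono, hmono.isSubEffectAlgebra_range, m, hm, huniq,
    hι.isStateOperator_of_leftInverse hm.isState hinv, fun α a => ?_⟩
  rw [hm.apply_tmul, id]
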